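/- **Encryption scheme.** Consider an additively homomorphic public-key encryption scheme. Given a security parameter $k$, key generation outputs a pair $(pk,sk)$. An integer $a$ (representing a plaintext modulo $N_{pk}\ge 1$) is encrypted with a nonce $r$, drawn uniformly from a finite abelian group $\mathcal R_{pk}$, to a ciphertext $\mathrm{Enc}_{pk}(a;r)$ in an abelian group. We have $\mathrm{Enc}_{pk}(a;r)\,\mathrm{Enc}_{pk}(b;s)=\mathrm{Enc}_{pk}(a+b;rs)$, and $\mathrm{Dec}_{sk}(\mathrm{Enc}_{pk}(a;r))=a \bmod N_{pk}$ for every key pair that can be generated. "Efficient" means: computable by a family (indexed by $k$) of non-uniform probabilistic straight-line programs of polynomial cost, which work on integers with bit-length-charged arithmetic, and which may also call the algorithms of the scheme at unit cost. For schemes whose algorithms run in polynomial time on representations of polynomial length, this amounts to probabilistic circuits of polynomial size. Two families of distributions are *computationally indistinguishable* if every efficient test has negligible advantage in distinguishing them. Assume that the scheme is *semantically secure*: for any two sequences of integer plaintexts of polynomial bit length, a public key together with a single encryption of the one is computationally indistinguishable from a public key together with a single encryption of the other. **Protocol.** Party $P_i$ ($i=1,2$) holds integer matrices $M_i$ ($m\times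 n$) and $Q_i$ ($n\times n$) and an integer vector $C_i$ of length $n$. Let $M=M_1+M_2$ and $C=C_1+C_2$. All encryptions are entrywise, with an independent nonce for every entry. 1. $P_1$ generates $(pk,sk)$ and sends $pk$, $M_1'=\mathrm{Enc}_{pk}(M_1)$ and $C_1'=\mathrm{Enc}_{pk}(C_1)$ to $P_2$. 2. $P_2$ encrypts $M_2$, $C_2$ (and $Q_2$) with $pk$, forms the entrywise products $M'=M_1'*M_2'$ and $C'=C_1'*C_2'$, computes $(MQ_2)'_{ij}=\prod_{l=1}^n (M'_{il})^{(Q_2)_{lj}}$ and $(C^TQ_2)'_{j}=\prod_{l=1}^n (C'_{l})^{(Q_2)_{lj}}$, and sends these to $P_1$. In the *refreshed variant*, $P_2$ first multiplies each of these ciphertexts by a fresh encryption of $0$. 3. $P_1$ computes $(MQ_2Q_1)'_{ij}=\prod_{l}((MQ_2)'_{il})^{(Q_1)_{lj}}$ and $(C^TQ_2Q_1)'_{j}=\prod_{l}((C^TQ_2)'_{l})^{(Q_1)_{lj}}$ and decrypts them with $sk$. The *view* of a party consists of its input, its coins (for $P_1$: the key pair and the nonces of $M_1'$, $C_1'$;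 for $P_2$: all its nonces) and the messages that it receives. **Theorem.** Let $m,n,\ell$ be polynomially bounded functions of $k$. The following holds for the protocol and also for its refreshed variant. (a) For all inputs, every generated key pair and all nonces, $P_1$'s decryptions are $MQ_2Q_1$ and $C^TQ_2Q_1$ modulo $N_{pk}$; every entry of absolute value less than $N_{pk}/2$ is thus obtained exactly, as the representative of least absolute value. (b) ($P_1$ learns only $MQ_2Q_1$ and $C^TQ_2Q_1$.) There is an efficient simulator that, on input $(M_1,C_1,Q_1)$ and $(MQ_2Q_1,\,C^TQ_2Q_1)$, outputs exactly the distribution of $P_1$'s view. This holds for all $k$ and all inputs with entries of at most $\ell(k)$ bits such that $Q_1$ and $Q_2$ are monomial (exactly one nonzero entry in each row and in each column) and, unless the protocol is refreshed, the nonzero entries of $Q_2$ are coprime to $|\mathcal R_{pk}|$ for every public key $pk$ that can be generated for $k$. (c) ($P_2$ learns nothing.) There is an efficient simulator that, on input $(M_2,C_2,Q_2)$ alone, outputs a distribution computationally indistinguishable from $P_2$'s view, for all sequences of inputs, indexed by $k$, with entries of at most $\ell(k)$ bits. -/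

import Mathlib

noncomputable section

namespace SecureLP

/-! ### Additively homomorphic public-key encryption -/

/-- An additively homomorphic public-key encryption scheme. A ciphertext is
`enc pk a r`, where `a` is an integer representing a plaintext modulo `modulus pk` and `r` is a
nonce, drawn uniformly from a finite abelian group (in the usual schemes, `enc pk a r` is
`g ^ a` times a value that depends homomorphically on `r`). Keys, nonces and ciphertexts have
representations as natural numbers, that is, as binary strings. The output of `gen k` is the pair
of public key and secret key for the security parameter `k`; the secret key may be taken to
contain all the coins of the key generation. -/
structure AddHomEnc where
  PK : Type
  SK : Type
  Nonce : PK → Type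
  Cipher : PK → Type
  [encodablePK : Encodable PK]
  [encodableSK : Encodable SK]
  [encodableNonce : ∀ pk, Encodable (Nonce pk)]
  [encodableCipher : ∀ pk, Encodable (Cipher pk)]
  [groupNonce : ∀ pk, CommGroup (Nonce pk)]
  [fintypeNonce : ∀ pk, Fintype (Nonce pk)]
  [groupCipher : ∀ pk, CommGroup (Cipher pk)]
  modulus : PK → ℕ
  modulus_pos : ∀ pk, 0 < modulus pk
  gen : ℕ → PMF (PK × SK)
  enc : ∀ pk, ℤ → Nonce pk → Cipher pk
  dec : SK → ∀ pk, Cipher pk → ZMod (modulus pk)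
  /-- The product of two ciphertexts is an encryption of the sum. -/
  enc_add : ∀ pk a b r s, enc pk (a + b) (r * s) = enc pk a r * enc pk b s
  /-- Decryption inverts encryption, for every key pair that can be generated. -/
  dec_enc : ∀ k, ∀ key ∈ (gen k).support, ∀ a r,
    dec key.2 key.1 (enc key.1 a r) = (a : ZMod (modulus key.1))

attribute [instance] AddHomEnc.encodablePK AddHomEnc.encodableSK AddHomEnc.encodableNonce
  AddHomEnc.encodableCipher AddHomEnc.groupNonce AddHomEnc.fintypeNonce AddHomEnc.groupCipher

/-- The representation of an object as a number. -/
def code {α : Type} [Encodable α] (a : α) : ℤ := (Encodable.encode a : ℤ)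

/-- The object represented by a number, if there is one. -/
def decode (α : Type) [Encodable α] (x : ℤ) : Option α := Encodable.decode x.toNat

/-! ### Efficient computation: non-uniform probabilistic straight-line programs

A program works on a list of integer registers. Arithmetic has an explicit word length `w`, which
is charged for, so that the total cost of a program bounds the number of bit operations up to a
polynomial. The algorithms of the encryption scheme are available as single instructions. When
these algorithms run in polynomial time on representations of polynomial length, families of
programs of polynomial cost compute exactly what polynomial-size probabilistic circuits compute. -/

inductive ArithOp
  | add | sub | mul | div | mod | le

/-- The value of an arithmetic operation; `le` is the comparison, with values `0` and `1`. -/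
def ArithOp.eval : ArithOp → ℤ → ℤ → ℤ
  | .add, a, b => a + b
  | .sub, a, b => a - b
  | .mul, a, b => a * b
  | .div, a, b => a / b
  | .mod, a, b => a % b
  | .le, a, b => if a ≤ b then 1 else 0

/-- Instructions; `i`, `j`, `l` are register numbers. -/
inductive Instr
  /-- append a constant -/
  | const (v : ℤ)
  /-- append the result of an operation on `w`-bit words (`0` on overflow) -/
  | arith (w : ℕ) (op : ArithOp) (i j : ℕ)
  /-- append a uniformly random bit -/
  | coin
  /-- keep the registers with the listed numbers, in the order of the list -/
  | select (idx : List ℕ)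
  /-- append a fresh public key and its secret key -/
  | gen
  /-- append a fresh nonce for the public key `i` -/
  | nonce (i : ℕ)
  /-- append the encryption of `j` with the public key `i` and the nonce `l` -/
  | enc (i j l : ℕ)
  /-- append the product of the ciphertexts `j` and `l` under the public key `i` -/
  | mul (i j l : ℕ)
  /-- append the inverse of the ciphertext `j` under the public key `i` -/
  | inv (i j : ℕ)
  /-- append the decryption of the ciphertext `l` with the secret key `i` and the public
  key `j` -/
  | dec (i j l : ℕ)

def Instr.cost : Instr → ℕ
  | .const v => v.natAbs.size + 1
  | .arith w _ _ _ => w + 1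
  | .select idx => idx.length + 1
  | _ => 1

abbrev Program := List Instr

def Program.cost (P : Program) : ℕ := (P.map Instr.cost).sum

/-- The content of register `i` (`0` if there is no such register). -/
def reg (s : List ℤ) (i : ℕ) : ℤ := s.getD i 0

namespace AddHomEnc

variable (E : AddHomEnc)

/-- One step, with security parameter `k`, from the register contents `s`. A scheme instruction
whose arguments are not valid representations appends `0`. -/
def step (k : ℕ) (s : List ℤ) : Instr → PMF (List ℤ)
  | .const v => PMF.pure (s ++ [v])
  | .arith w op i j =>
      PMF.pure (s ++ [if (op.eval (reg s i) (reg s j)).natAbs < 2 ^ w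
        then op.eval (reg s i) (reg s j) else 0])
  | .coin => (PMF.uniformOfFintype Bool).map fun b => s ++ [if b then 1 else 0]
  | .select idx => PMF.pure (idx.map (reg s))
  | .gen => (E.gen k).map fun key => s ++ [code key.1, code key.2]
  | .nonce i =>
      match decode E.PK (reg s i) with
      | none => PMF.pure (s ++ [0])
      | some pk => (PMF.uniformOfFintype (E.Nonce pk)).map fun r => s ++ [code r]
  | .enc i j l =>
      match decode E.PK (reg s i) with
      | none => PMF.pure (s ++ [0])
      | some pk =>
        match decode (E.Nonce pk) (reg s l) with
        | none => PMF.pure (s ++ [0])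
        | some r => PMF.pure (s ++ [code (E.enc pk (reg s j) r)])
  | .mul i j l =>
      match decode E.PK (reg s i) with
      | none => PMF.pure (s ++ [0])
      | some pk =>
        match decode (E.Cipher pk) (reg s j), decode (E.Cipher pk) (reg s l) with
        | some c, some d => PMF.pure (s ++ [code (c * d)])
        | _, _ => PMF.pure (s ++ [0])
  | .inv i j =>
      match decode E.PK (reg s i) with
      | none => PMF.pure (s ++ [0])
      | some pk =>
        match decode (E.Cipher pk) (reg s j) with
        | none => PMF.pure (s ++ [0])
        | some c => PMF.pure (s ++ [code c⁻¹])
  | .dec i j l =>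
      match decode E.SK (reg s i), decode E.PK (reg s j) with
      | some sk, some pk =>
        match decode (E.Cipher pk) (reg s l) with
        | none => PMF.pure (s ++ [0])
        | some c => PMF.pure (s ++ [(E.dec sk pk c).valMinAbs])
      | _, _ => PMF.pure (s ++ [0])

/-- The distribution of the final register contents of a program. -/
def run (k : ℕ) : Program → List ℤ → PMF (List ℤ)
  | [], s => PMF.pure s
  | a :: P, s => (E.step k s a).bind (run k P)

/-- The probability that the program `D` accepts, that is, ends with `1` in the last register,
when its input is drawn from `μ`. -/
def acceptProb (k : ℕ) (D : Program) (μ : PMF (List ℤ)) : ℝ :=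
  (((μ.bind (E.run k D)).map fun s => decide (s.getLast? = some 1)) true).toReal

end AddHomEnc

def PolyBounded (f : ℕ → ℕ) : Prop := ∃ p : Polynomial ℕ, ∀ k, f k ≤ p.eval k

def Negligible (f : ℕ → ℝ) : Prop :=
  Asymptotics.SuperpolynomialDecay Filter.atTop (fun k : ℕ => (k : ℝ)) f

namespace AddHomEnc

variable (E : AddHomEnc)

/-- Two families of distributions are computationally indistinguishable: every family of programs
of polynomial cost has negligible advantage in telling them apart. -/
def Indistinguishable (μ ν : ℕ → PMF (List ℤ)) : Prop :=
  ∀ D : ℕ → Program, PolyBounded (fun k => (D k).cost) →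
    Negligible fun k => |E.acceptProb k (D k) (μ k) - E.acceptProb k (D k) (ν k)|

/-- A fresh public key together with a single encryption of `a` under it. -/
def encryption (k : ℕ) (a : ℤ) : PMF (List ℤ) :=
  (E.gen k).bind fun key =>
    (PMF.uniformOfFintype (E.Nonce key.1)).map fun r => [code key.1, code (E.enc key.1 a r)]

/-- Semantic security, as indistinguishability of encryptions: given the public key, a single
encryption of one plaintext cannot be told from a single encryption of another. -/
def SemanticallySecure : Prop :=
  ∀ a b : ℕ → ℤ, PolyBounded (fun k => (a k).natAbs.size) →
    PolyBounded (fun k => (b k).natAbs.size) →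
    E.Indistinguishable (fun k => E.encryption k (a k)) (fun k => E.encryption k (b k))

end AddHomEnc

/-! ### The inputs -/

/-- The input of one party: its shares of the `m × n` constraint matrix and of the objective
vector, and its `n × n` transformation matrix. -/
structure Input (m n : ℕ) where
  M : Matrix (Fin m) (Fin n) ℤ
  C : Fin n → ℤ
  Q : Matrix (Fin n) (Fin n) ℤ

/-- A monomial matrix: exactly one nonzero entry in every row and in every column. -/
def IsMonomial {n : ℕ} (Q : Matrix (Fin n) (Fin n) ℤ) : Prop :=
  (∀ i, ∃! j, Q i j ≠ 0) ∧ ∀ j, ∃! i, Q i j ≠ 0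

/-- An `m × n` matrix together with a vector of length `n`. -/
abbrev MatVec (α : Type) (m n : ℕ) := (Fin m → Fin n → α) × (Fin n → α)

namespace Input

variable {m n : ℕ}

/-- All entries have at most `ℓ` bits. -/
def HasBits (x : Input m n) (ℓ : ℕ) : Prop :=
  (∀ i j, (x.M i j).natAbs < 2 ^ ℓ) ∧ (∀ j, (x.C j).natAbs < 2 ^ ℓ) ∧
    ∀ i j, (x.Q i j).natAbs < 2 ^ ℓ

/-- The transformed data `M Q₂ Q₁` and `Cᵀ Q₂ Q₁`, where `M = M₁ + M₂` and `C = C₁ + C₂`, from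
the inputs `x` of the first and `y` of the second party. -/
def transformed (x y : Input m n) : MatVec ℤ m n :=
  ((x.M + y.M) * y.Q * x.Q, Matrix.vecMul (x.C + y.C) (y.Q * x.Q))

end Input

/-- The entries of a matrix as a list, row by row. -/
def matList {α : Type} {m n : ℕ} (A : Fin m → Fin n → α) : List α :=
  (List.ofFn fun i => List.ofFn (A i)).flatten

def MatVec.toList {α : Type} {m n : ℕ} (A : MatVec α m n) : List α :=
  matList A.1 ++ List.ofFn A.2

def Input.toList {m n : ℕ} (x : Input m n) : List ℤ :=
  MatVec.toList (x.M, x.C) ++ matList x.Q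

/-! ### The protocol -/

namespace AddHomEnc

variable (E : AddHomEnc) {m n : ℕ}

/-- Entrywise encryption of the shares `M` and `C` of a party, with one nonce per entry. -/
def encShares (pk : E.PK) (x : Input m n) (r : MatVec (E.Nonce pk) m n) :
    MatVec (E.Cipher pk) m n :=
  (fun i j => E.enc pk (x.M i j) (r.1 i j), fun j => E.enc pk (x.C j) (r.2 j))

/-- Entrywise product of ciphertexts. -/
def mulEntries (pk : E.PK) (c d : MatVec (E.Cipher pk) m n) : MatVec (E.Cipher pk) m n :=
  (fun i j => c.1 i j * d.1 i j, fun j => c.2 j * d.2 j)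

/-- Multiplication of the encrypted matrix and vector by the plain matrix `Q` from the right:
the entry `(i, j)` of the result is the product over `l` of the `Q l j`-th powers of the entries
`(i, l)`. -/
def mulRight (pk : E.PK) (c : MatVec (E.Cipher pk) m n) (Q : Matrix (Fin n) (Fin n) ℤ) :
    MatVec (E.Cipher pk) m n :=
  (fun i j => ∏ l, c.1 i l ^ Q l j, fun j => ∏ l, c.2 l ^ Q l j)

/-- The coins of the second party: the nonces for its encryptions of `M₂`, `C₂`, those for its
encryption of `Q₂`, and those for the optional refreshing of the ciphertexts it sends. -/
abbrev Coins₂ (pk : E.PK) (m n : ℕ) :=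
  MatVec (E.Nonce pk) m n × (Fin n → Fin n → E.Nonce pk) × MatVec (E.Nonce pk) m n

/-- The message of the second party, the encryptions of `M Q₂` and `Cᵀ Q₂`, in reply to the
encryptions `c` of `M₁` and `C₁`. If `fresh` is true, each of these ciphertexts is in addition
multiplied by a fresh encryption of `0`. -/
def reply (fresh : Bool) (pk : E.PK) (y : Input m n) (c : MatVec (E.Cipher pk) m n)
    (s : E.Coins₂ pk m n) : MatVec (E.Cipher pk) m n :=
  let d := E.mulRight pk (E.mulEntries pk c (E.encShares pk y s.1)) y.Q
  if fresh then
    E.mulEntries pk d (fun i j => E.enc pk 0 (s.2.2.1 i j), fun j => E.enc pk 0 (s.2.2.2 j))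
  else d

/-- What the first party decrypts in the end, when the second party's message is `d`. -/
def decrypted (pk : E.PK) (sk : E.SK) (x : Input m n) (d : MatVec (E.Cipher pk) m n) :
    MatVec (ZMod (E.modulus pk)) m n :=
  let e := E.mulRight pk d x.Q
  (fun i j => E.dec sk pk (e.1 i j), fun j => E.dec sk pk (e.2 j))

/-- The representation of a matrix and a vector of nonces or ciphertexts. -/
def codes {α : Type} [Encodable α] (c : MatVec α m n) : List ℤ := (MatVec.toList c).map code

/-- The view of the first party (input, keys, nonces, received message) in a run of the protocol
on the inputs `x`, `y`. -/
def view₁ (fresh : Bool) (k : ℕ) (x y : Input m n) : PMF (List ℤ) :=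
  (E.gen k).bind fun key =>
    (PMF.uniformOfFintype (MatVec (E.Nonce key.1) m n)).bind fun r =>
      (PMF.uniformOfFintype (E.Coins₂ key.1 m n)).map fun s =>
        x.toList ++ [code key.1, code key.2] ++ codes r ++
          codes (E.reply fresh key.1 y (E.encShares key.1 x r) s)

/-- The view of the second party (input, nonces, received public key and ciphertexts) in a run of
the protocol on the inputs `x`, `y`. The refreshing nonces are drawn only if they are used. -/
def view₂ (fresh : Bool) (k : ℕ) (x y : Input m n) : PMF (List ℤ) :=
  (E.gen k).bind fun key =>
    (PMF.uniformOfFintype (MatVec (E.Nonce key.1) m n)).bind fun r =>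
      (PMF.uniformOfFintype (E.Coins₂ key.1 m n)).map fun s =>
        y.toList ++ (codes s.1 ++ (matList s.2.1).map code ++
          if fresh then codes s.2.2 else []) ++
          [code key.1] ++ codes (E.encShares key.1 x r)

/-- The nonzero entries of `Q` are invertible as exponents of nonces: they are coprime to the order
of the nonce group, for every public key that can be generated. -/
def CoprimeToNonces (k : ℕ) (Q : Matrix (Fin n) (Fin n) ℤ) : Prop :=
  ∀ key ∈ (E.gen k).support, ∀ i j, Q i j ≠ 0 →
    (Q i j).natAbs.Coprime (Fintype.card (E.Nonce key.1))

end AddHomEnc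

end SecureLP

end

open SecureLP

/-!
Encryption is a homomorphism from the group of pairs of a plaintext and a nonce to the group of
ciphertexts, so the protocol computes on encryptions what is claimed in the clear, and the second
party's message consists of encryptions of `M Q₂` and `Cᵀ Q₂` with certain nonces (`reply_eq`).

For the privacy of the second party, these plaintexts are determined by the first party's input and
the transformed data, as `Q₁` is monomial: each is a sum of quotients of which all but one are
divisions by zero, which makes them computable by a straight-line program (`IsMonomial.div_eq`,
`run_divideOut`). The nonces in the message are uniformly random and independent of the first
party's own nonces (`map_replyNonces`): in the refreshed variant because they are multiplied by
fresh ones, and otherwise because raising to powers coprime to the order of the nonce group and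
permuting the columns is a bijection. Hence encrypting the recovered plaintexts with fresh nonces
reproduces the view exactly (`run_simulator₁`).

For the privacy of the first party, the simulator replaces all ciphertexts that the second party
receives by encryptions of zero. A hybrid argument replaces one ciphertext at a time; the step with
the largest advantage, with the inputs of both parties hard-wired, is a test of single encryptions
(`exists_reduction`). Its advantage is negligible by semantic security, and there are polynomially
many steps. Resampling one nonce of a uniform family does not change its distribution
(`uniformOfFintype_bind_update`), so the reduction may prepare all ciphertexts and then overwrite
one of them with its challenge.
-/

open Function

noncomputable section

namespace SecureLP

/-! ### Uniform distributions -/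

section Uniform

variable {α β γ : Type} [Fintype α] [Nonempty α] [Fintype β] [Nonempty β]

lemma map_uniformOfFintype_of_bijective {f : α → β} (hf : Bijective f) :
    (PMF.uniformOfFintype α).map f = PMF.uniformOfFintype β := by
  ext b
  obtain ⟨a, rfl⟩ := hf.2 b
  rw [PMF.map_apply, tsum_eq_single a]
  · simp [Fintype.card_of_bijective hf]
  · intro a' ha'
    rw [if_neg]
    exact fun h => ha' (hf.1 h).symm

lemma uniformOfFintype_prod :
    PMF.uniformOfFintype (α × β) =
      (PMF.uniformOfFintype α).bind fun a => (PMF.uniformOfFintype β).map (Prod.mk a) := by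
  ext ⟨a, b⟩
  rw [PMF.bind_apply, tsum_eq_single a, PMF.map_apply, tsum_eq_single b]
  · simp only [PMF.uniformOfFintype_apply, Fintype.card_prod, if_true]
    rw [Nat.cast_mul, ENNReal.mul_inv (by simp) (by simp)]
  · intro b' hb'
    rw [if_neg]
    simpa using hb'.symm
  · intro a' ha'
    rw [PMF.map_apply, ENNReal.tsum_eq_zero.2, mul_zero]
    intro b'
    rw [if_neg]
    simp [ha'.symm]

lemma map_fst_uniformOfFintype :
    (PMF.uniformOfFintype (α × β)).map Prod.fst = PMF.uniformOfFintype α := by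
  rw [uniformOfFintype_prod, PMF.map_bind]
  simp_rw [PMF.map_comp]
  change (PMF.uniformOfFintype α).bind (fun a => PMF.map (Function.const _ a) _) = _
  simp_rw [PMF.map_const]
  exact PMF.bind_pure _

lemma map_snd_uniformOfFintype :
    (PMF.uniformOfFintype (α × β)).map Prod.snd = PMF.uniformOfFintype β := by
  rw [uniformOfFintype_prod, PMF.map_bind]
  simp_rw [PMF.map_comp]
  change (PMF.uniformOfFintype α).bind (fun a => PMF.map id _) = _
  simp_rw [PMF.map_id]
  exact PMF.bind_const _ _

lemma uniformOfFintype_fin_succ (N : ℕ) :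
    PMF.uniformOfFintype (Fin (N + 1) → α) =
      (PMF.uniformOfFintype (Fin N → α)).bind fun f =>
        (PMF.uniformOfFintype α).map fun a => Fin.snoc f a := by
  have hf : Bijective fun p : (Fin N → α) × α => (Fin.snoc p.1 p.2 : Fin (N + 1) → α) := by
    refine ⟨fun p q h => ?_, fun g => ⟨(Fin.init g, g (Fin.last N)), Fin.snoc_init_self g⟩⟩
    have h := Fin.snoc_injective2 h
    exact Prod.ext h.1 h.2
  rw [← map_uniformOfFintype_of_bijective hf, uniformOfFintype_prod, PMF.map_bind]
  simp_rw [PMF.map_comp]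
  rfl

/-- Resampling one coordinate of a uniformly random family leaves its distribution unchanged. -/
lemma uniformOfFintype_bind_update {N : ℕ} (i : Fin N) (F : (Fin N → α) → γ) :
    ((PMF.uniformOfFintype α).bind fun a =>
      (PMF.uniformOfFintype (Fin N → α)).map fun f => F (update f i a)) =
      (PMF.uniformOfFintype (Fin N → α)).map F := by
  -- swapping the new value with the old one is an involution of the product
  have hσ : Involutive fun p : α × (Fin N → α) => (p.2 i, update p.2 i p.1) := by
    rintro ⟨a, f⟩
    simp
  have h := congrArg (PMF.map (F ∘ Prod.snd)) (map_uniformOfFintype_of_bijective hσ.bijective)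
  rw [PMF.map_comp, ← PMF.map_comp Prod.snd _ F, map_snd_uniformOfFintype,
    uniformOfFintype_prod, PMF.map_bind] at h
  simp_rw [PMF.map_comp] at h
  exact h

end Uniform

lemma bind_congr_of_mem_support {α β : Type} (p : PMF α) {f g : α → PMF β}
    (h : ∀ a ∈ p.support, f a = g a) : p.bind f = p.bind g := by
  ext b
  rw [PMF.bind_apply, PMF.bind_apply]
  refine tsum_congr fun a => ?_
  by_cases ha : a ∈ p.support
  · rw [h a ha]
  · rw [(PMF.apply_eq_zero_iff p a).2 ha, zero_mul, zero_mul]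

/-! ### Registers and lists of entries -/

lemma reg_append_left {A B : List ℤ} {i : ℕ} (h : i < A.length) : reg (A ++ B) i = reg A i := by
  simp [reg, List.getElem?_append_left h]

lemma reg_append_right {A B : List ℤ} (i : ℕ) : reg (A ++ B) (A.length + i) = reg B i := by
  simp [reg, List.getElem?_append_right]

/-- Reading off a segment of the register list. -/
lemma map_reg_range' {s A B C : List ℤ} {p q : ℕ} (hs : s = A ++ B ++ C) (hp : p = A.length)
    (hq : q = B.length) : (List.range' p q).map (reg s) = B := by
  subst hs hp hq
  refine List.ext_getElem (by simp) fun i h₁ h₂ => ?_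
  rw [List.getElem_map, List.getElem_range', one_mul, List.append_assoc, reg_append_right,
    reg_append_left h₂]
  simp [reg, h₂]

/-- Reading off a single register of a segment. -/
lemma reg_of_eq_append {s A B C : List ℤ} {p i : ℕ} (hs : s = A ++ B ++ C) (hp : p = A.length)
    (hi : i < B.length) : reg s (p + i) = B[i] := by
  subst hs hp
  rw [List.append_assoc, reg_append_right, reg_append_left hi]
  simp [reg, hi]

lemma decode_code {α : Type} [Encodable α] (a : α) : decode α (code a) = some a := by
  simp [decode, code]

lemma map_range_eq_ofFn {N : ℕ} {v : ℕ → ℤ} {f : Fin N → ℤ} (h : ∀ e : Fin N, v e = f e) :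
    (List.range N).map v = List.ofFn f :=
  List.ext_getElem (by simp) fun e h₁ h₂ => by
    simpa using h ⟨e, by simpa using h₁⟩

lemma set_ofFn {N : ℕ} (f : Fin N → ℤ) (j : Fin N) (a : ℤ) :
    (List.ofFn f).set j a = List.ofFn (update f j a) :=
  List.ext_getElem (by simp) fun i h₁ h₂ => by
    simp [List.getElem_set, update_apply, Fin.ext_iff, eq_comm]

lemma matList_eq_ofFn {α : Type} {m n : ℕ} (A : Fin m → Fin n → α) :
    matList A = List.ofFn fun e : Fin (m * n) => A e.divNat e.modNat := by
  rw [List.ofFn_mul, matList]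
  congr 2
  funext i
  congr 1
  funext j
  have hn : 0 < n := j.pos
  congr 1 <;> apply Fin.ext
  · simp [Fin.divNat, Nat.add_comm (i.1 * n), Nat.add_mul_div_right _ _ hn,
      Nat.div_eq_of_lt j.2]
  · simp [Fin.modNat, Nat.add_comm (i.1 * n), Nat.mod_eq_of_lt j.2]

@[simp] lemma length_matList {α : Type} {m n : ℕ} (A : Fin m → Fin n → α) :
    (matList A).length = m * n := by
  simp [matList_eq_ofFn]

lemma reg_matList {m n : ℕ} (A : Fin m → Fin n → ℤ) (i : Fin m) (j : Fin n) :
    reg (matList A) (i * n + j) = A i j := by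
  have hn : 0 < n := j.pos
  have h : (i : ℕ) * n + j < m * n :=
    (Nat.add_lt_add_left j.2 _).trans_le
      (by rw [← Nat.succ_mul]; exact Nat.mul_le_mul_right _ i.2)
  rw [matList_eq_ofFn, reg, List.getD_eq_getElem _ _ (by simpa using h), List.getElem_ofFn]
  congr 1 <;> apply Fin.ext
  · simp [Fin.divNat, Nat.add_comm (i.1 * n), Nat.add_mul_div_right _ _ hn,
      Nat.div_eq_of_lt j.2]
  · simp [Fin.modNat, Nat.add_comm (i.1 * n), Nat.mod_eq_of_lt j.2]

namespace MatVec

variable {α : Type} {m n : ℕ}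

/-- The matrix with the vector as an additional last row. -/
def rows (A : MatVec α m n) : Fin (m + 1) → Fin n → α :=
  Fin.snoc (α := fun _ => Fin n → α) A.1 A.2

@[simp] lemma rows_castSucc (A : MatVec α m n) (i : Fin m) : rows A i.castSucc = A.1 i := by
  simp [rows]

@[simp] lemma rows_last (A : MatVec α m n) : rows A (Fin.last m) = A.2 := by
  simp [rows]

lemma toList_eq_matList (A : MatVec α m n) : toList A = matList (rows A) := by
  rw [matList, List.ofFn_succ']
  simp [toList, matList, -List.ofFn_succ]

/-- The entries, row by row, the entries of the vector last. -/
def entries (A : MatVec α m n) (e : Fin ((m + 1) * n)) : α := rows A e.divNat e.modNat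

lemma toList_eq_ofFn (A : MatVec α m n) : toList A = List.ofFn (entries A) := by
  rw [toList_eq_matList, matList_eq_ofFn]
  rfl

@[simp] lemma length_toList (A : MatVec α m n) : (toList A).length = (m + 1) * n := by
  simp [toList_eq_ofFn]

lemma entries_bijective : Bijective (entries : MatVec α m n → Fin ((m + 1) * n) → α) := by
  have h₁ : Bijective (rows : MatVec α m n → Fin (m + 1) → Fin n → α) := by
    refine ⟨fun A B h => ?_, fun g => ⟨(Fin.init g, g (Fin.last m)), Fin.snoc_init_self g⟩⟩
    have h := Fin.snoc_injective2 (α := fun _ => Fin n → α) h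
    exact Prod.ext h.1 h.2
  have h₂ := (((Equiv.curry (Fin (m + 1)) (Fin n) α).symm.trans
    (finProdFinEquiv.arrowCongr (Equiv.refl α)))).bijective
  exact h₂.comp h₁

end MatVec

/-! ### Subprograms and their costs -/

namespace Program

/-- Append the given constants. -/
def consts (l : List ℤ) : Program := l.map Instr.const

/-- Append `N` fresh nonces for the public key in register `i`. -/
def nonces (i N : ℕ) : Program :=
  (List.range N).flatMap fun _ => [Instr.nonce i]

/-- Append encryptions under the public key in register `i` of the `N` plaintexts from register
`p` on, with the nonces from register `q` on. -/
def encs (i p q N : ℕ) : Program :=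
  (List.range N).flatMap fun e => [Instr.enc i (p + e) (q + e)]

/-- Append the sum of the `n` quotients of the registers from `a` on by the registers from `b` on,
when there are `p` registers. The partial sum is kept in register `p`. -/
def sumDiv (w p a b n : ℕ) : Program :=
  .const 0 :: (List.range n).flatMap fun j =>
    [.arith w .div (a + j) (b + j), .arith w .add p (p + 1), .select (List.range' 0 p ++ [p + 2])]

lemma cost_append (P Q : Program) :
    cost (P ++ Q) = cost P + cost Q := by
  simp [Program.cost]

lemma cost_flatMap_range_le {B : ℕ → Program} {N c : ℕ}
    (h : ∀ e < N, cost (B e) ≤ c) :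
    cost ((List.range N).flatMap B) ≤ N * c := by
  induction N with
  | zero => simp [Program.cost]
  | succ N ih =>
    rw [List.range_succ, List.flatMap_append, cost_append, Nat.succ_mul]
    have := h N N.lt_succ_self
    have := ih fun e he => h e (he.trans N.lt_succ_self)
    simp only [List.flatMap_singleton]
    omega

lemma cost_consts_le {l : List ℤ} {b : ℕ} (h : ∀ a ∈ l, a.natAbs < 2 ^ b) :
    cost (consts l) ≤ l.length * (b + 1) := by
  induction l with
  | nil => simp [consts, cost]
  | cons a l ih =>
    have h₁ := Nat.size_le.2 (h a (by simp))
    have h₂ := ih fun a ha => h a (List.mem_cons_of_mem _ ha)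
    change (Instr.const a).cost + cost (consts l) ≤ _
    rw [List.length_cons, Nat.succ_mul, Instr.cost]
    omega

lemma cost_nonces_le (i N : ℕ) : cost (nonces i N) ≤ N := by
  simpa [nonces] using cost_flatMap_range_le (B := fun _ => [Instr.nonce i]) (N := N) (c := 1)
    (by simp [Program.cost, Instr.cost])

lemma cost_encs_le (i p q N : ℕ) : cost (encs i p q N) ≤ N := by
  simpa [encs] using cost_flatMap_range_le (c := 1) (N := N)
    (B := fun e => [Instr.enc i (p + e) (q + e)]) (by simp [Program.cost, Instr.cost])

lemma cost_sumDiv_le (w p a b n : ℕ) :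
    cost (sumDiv w p a b n) ≤ 1 + n * (2 * w + p + 4) := by
  rw [sumDiv, ← List.singleton_append, cost_append]
  refine Nat.add_le_add (by simp [Program.cost, Instr.cost]) (cost_flatMap_range_le fun e _ => ?_)
  simp [Program.cost, Instr.cost]
  omega

end Program

namespace AddHomEnc

open Program

variable (E : AddHomEnc) (k : ℕ)

/-! ### Running programs -/

lemma run_append (P Q : Program) (s : List ℤ) :
    E.run k (P ++ Q) s = (E.run k P s).bind (E.run k Q) := by
  induction P generalizing s with
  | nil => simp [run]
  | cons a P ih =>
    simp only [List.cons_append, run, PMF.bind_bind]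
    congr 1
    funext t
    exact ih t

@[simp] lemma run_nil (s : List ℤ) : E.run k [] s = PMF.pure s := rfl

@[simp] lemma run_singleton (a : Instr) (s : List ℤ) : E.run k [a] s = E.step k s a := by
  simp only [run]
  exact PMF.bind_pure _

lemma run_cons (a : Instr) (P : Program) (s : List ℤ) :
    E.run k (a :: P) s = (E.step k s a).bind (E.run k P) := rfl

/-- A loop invariant: the distribution of the registers after each round of a loop. -/
lemma run_loop {B : ℕ → Program} {σ : ℕ → PMF (List ℤ)} {N : ℕ}
    (h : ∀ e < N, (σ e).bind (E.run k (B e)) = σ (e + 1)) :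
    (σ 0).bind (E.run k ((List.range N).flatMap B)) = σ N := by
  induction N with
  | zero =>
    change (σ 0).bind PMF.pure = _
    exact PMF.bind_pure _
  | succ N ih =>
    rw [List.range_succ, List.flatMap_append, funext (E.run_append k _ _), ← PMF.bind_bind,
      ih fun e he => h e (he.trans N.lt_succ_self)]
    simpa using h N N.lt_succ_self

/-- A loop whose rounds append one deterministic value each. -/
lemma run_loop_append {B : ℕ → Program} {s : List ℤ} {v : ℕ → ℤ} {N : ℕ}
    (h : ∀ e < N, ∀ t, t.length = e → E.run k (B e) (s ++ t) = PMF.pure (s ++ t ++ [v e])) :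
    E.run k ((List.range N).flatMap B) s = PMF.pure (s ++ (List.range N).map v) := by
  have := E.run_loop k (B := B) (σ := fun e => PMF.pure (s ++ (List.range e).map v)) (N := N)
    (fun e he => by
      rw [PMF.pure_bind, h e he _ (by simp), List.range_succ]
      simp)
  simpa using this

lemma run_consts (l s : List ℤ) : E.run k (consts l) s = PMF.pure (s ++ l) := by
  induction l generalizing s with
  | nil => simp [consts]
  | cons a l ih =>
    change (PMF.pure (s ++ [a])).bind (E.run k (consts l)) = _
    rw [PMF.pure_bind, ih]
    simp

lemma run_nonces {s : List ℤ} {pk : E.PK} {i N : ℕ} (hi : i < s.length)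
    (hpk : reg s i = code pk) :
    E.run k (nonces i N) s = (PMF.uniformOfFintype (Fin N → E.Nonce pk)).map fun r =>
      s ++ List.ofFn fun e => code (r e) := by
  have := E.run_loop k (B := fun _ => [Instr.nonce i])
    (σ := fun e => (PMF.uniformOfFintype (Fin e → E.Nonce pk)).map fun r =>
      s ++ List.ofFn fun e => code (r e)) (N := N)
    (fun e he => by
      rw [uniformOfFintype_fin_succ, PMF.map_bind, PMF.bind_map]
      congr 1
      funext r
      simp only [comp_apply, run_singleton, step, reg_append_left hi, hpk, decode_code]
      rw [PMF.map_comp]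
      congr 1
      funext a
      simp [List.ofFn_succ', -List.ofFn_succ])
  rw [← nonces] at this
  rw [← this]
  have h0 : (fun r : Fin 0 → E.Nonce pk => s ++ List.ofFn fun e => code (r e)) =
      Function.const _ s := by
    funext r
    simp
  rw [h0, PMF.map_const, PMF.pure_bind]

lemma run_encs {s A A' C C' : List ℤ} {pk : E.PK} {i p q N : ℕ} {r : Fin N → E.Nonce pk}
    {v : Fin N → ℤ} (hi : i < s.length) (hpk : reg s i = code pk)
    (hV : s = A ++ List.ofFn v ++ C) (hp : p = A.length)
    (hr : s = A' ++ (List.ofFn fun e => code (r e)) ++ C') (hq : q = A'.length) :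
    E.run k (encs i p q N) s =
      PMF.pure (s ++ List.ofFn fun e => code (E.enc pk (v e) (r e))) := by
  have hlp := congrArg List.length hV
  have hlq := congrArg List.length hr
  simp only [List.length_append, List.length_ofFn] at hlp hlq
  rw [encs, E.run_loop_append k (v := fun e =>
    if h : e < N then code (E.enc pk (v ⟨e, h⟩) (r ⟨e, h⟩)) else 0)]
  · rw [map_range_eq_ofFn]
    simp
  · intro e he t _
    rw [run_singleton, step, reg_append_left hi, hpk, decode_code, reg_append_left (by omega),
      reg_append_left (by omega), reg_of_eq_append hr hq (by simpa using he),
      reg_of_eq_append hV hp (by simpa using he)]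
    simp [decode_code, he]

lemma step_arith {s : List ℤ} {w i j : ℕ} {op : ArithOp}
    (h : (op.eval (reg s i) (reg s j)).natAbs < 2 ^ w) :
    E.step k s (.arith w op i j) = PMF.pure (s ++ [op.eval (reg s i) (reg s j)]) := by
  rw [step, if_pos h]

lemma run_select (s : List ℤ) (idx : List ℕ) :
    E.run k [.select idx] s = PMF.pure (idx.map (reg s)) := by
  rw [run_singleton, step]

lemma run_sumDiv {s : List ℤ} {w p a b n : ℕ} (hp : p = s.length) (ha : a + n ≤ p)
    (hb : b + n ≤ p)
    (hdiv : ∀ j < n, (reg s (a + j) / reg s (b + j)).natAbs < 2 ^ w)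
    (hsum : ∀ j ≤ n, (∑ l ∈ Finset.range j, reg s (a + l) / reg s (b + l)).natAbs < 2 ^ w) :
    E.run k (sumDiv w p a b n) s =
      PMF.pure (s ++ [∑ j ∈ Finset.range n, reg s (a + j) / reg s (b + j)]) := by
  subst hp
  have := E.run_loop k (N := n)
    (B := fun j => [.arith w .div (a + j) (b + j), .arith w .add s.length (s.length + 1),
      .select (List.range' 0 s.length ++ [s.length + 2])])
    (σ := fun j => PMF.pure (s ++ [∑ l ∈ Finset.range j, reg s (a + l) / reg s (b + l)]))
    (fun j hj => by
      have h := hsum (j + 1) hj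
      rw [Finset.sum_range_succ] at h
      rw [PMF.pure_bind, Finset.sum_range_succ]
      generalize hS : ∑ l ∈ Finset.range j, reg s (a + l) / reg s (b + l) = S at h ⊢
      have h₀ : ∀ x y z, reg (s ++ [x] ++ [y] ++ [z]) (s.length + 2) = z := fun x y z => by
        simp [reg]
      have h₁ : ∀ x y, reg (s ++ [x] ++ [y]) (s.length) = x := fun x y => by
        simp [reg]
      have h₂ : ∀ x y, reg (s ++ [x] ++ [y]) (s.length + 1) = y := fun x y => by
        simp [reg]
      have hA : reg (s ++ [S]) (a + j) = reg s (a + j) := reg_append_left (by omega)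
      have hB : reg (s ++ [S]) (b + j) = reg s (b + j) := reg_append_left (by omega)
      rw [run_cons, step_arith _ _ (by rw [hA, hB]; exact hdiv j hj), PMF.pure_bind, hA, hB,
        run_cons, step_arith _ _ (by rw [h₁, h₂]; exact h), PMF.pure_bind, run_select, h₁, h₂]
      simp only [ArithOp.eval]
      rw [List.map_append, List.map_singleton, h₀,
        map_reg_range' (p := 0) (A := []) (B := s) (by simp; rfl) rfl rfl])
  rw [sumDiv, run_cons, step, PMF.pure_bind, ← this, Finset.sum_range_zero, PMF.pure_bind]

end AddHomEnc

/-! ### Plain and encrypted matrix products -/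

lemma valMinAbs_intCast {N : ℕ} (hN : 0 < N) {a : ℤ} (ha : 2 * a.natAbs < N) :
    (a : ZMod N).valMinAbs = a := by
  have : NeZero N := ⟨hN.ne'⟩
  rw [ZMod.valMinAbs_spec]
  refine ⟨rfl, ?_, ?_⟩ <;> omega

namespace MatVec

variable {m n : ℕ}

/-- The product of a matrix and of a row vector with the matrix `Q` from the right. -/
def mul (A : MatVec ℤ m n) (Q : Matrix (Fin n) (Fin n) ℤ) : MatVec ℤ m n :=
  (fun i j => ∑ l, A.1 i l * Q l j, fun j => ∑ l, A.2 l * Q l j)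

/-- The multiplicative analogue of `MatVec.mul`: the entries of `Q` are exponents. -/
def zpowMul {G : Type} [CommGroup G] (c : MatVec G m n) (Q : Matrix (Fin n) (Fin n) ℤ) :
    MatVec G m n :=
  (fun i j => ∏ l, c.1 i l ^ Q l j, fun j => ∏ l, c.2 l ^ Q l j)

lemma rows_mul (A : MatVec ℤ m n) (Q : Matrix (Fin n) (Fin n) ℤ) (i : Fin (m + 1)) (j : Fin n) :
    rows (mul A Q) i j = ∑ l, rows A i l * Q l j := by
  induction i using Fin.lastCases with
  | last => simp only [rows_last, mul]
  | cast i => simp only [rows_castSucc, mul]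

end MatVec

/-- The sums of the shares of the two parties. -/
def Input.sum {m n : ℕ} (x y : Input m n) : MatVec ℤ m n :=
  (fun i j => x.M i j + y.M i j, fun j => x.C j + y.C j)

lemma Input.length_toList {m n : ℕ} (x : Input m n) : x.toList.length = (m + 1) * n + n * n := by
  rw [Input.toList, List.length_append, MatVec.length_toList, length_matList (m := n) x.Q]

lemma Input.transformed_eq {m n : ℕ} (x y : Input m n) :
    x.transformed y = ((x.sum y).mul y.Q).mul x.Q := by
  refine Prod.ext rfl ?_
  change Matrix.vecMul (x.C + y.C) (y.Q * x.Q) = Matrix.vecMul (Matrix.vecMul (x.C + y.C) y.Q) x.Q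
  exact (Matrix.vecMul_vecMul _ _ _).symm

namespace AddHomEnc

variable (E : AddHomEnc) {m n : ℕ}

/-- Encryption as a homomorphism of groups. -/
def encHom (pk : E.PK) : Multiplicative ℤ × E.Nonce pk →* E.Cipher pk :=
  MonoidHom.mk' (fun p => E.enc pk p.1.toAdd p.2) fun _ _ => E.enc_add pk _ _ _ _

lemma prod_enc_zpow (pk : E.PK) {ι : Type} [Fintype ι] (a : ι → ℤ) (r : ι → E.Nonce pk)
    (q : ι → ℤ) :
    ∏ l, E.enc pk (a l) (r l) ^ q l = E.enc pk (∑ l, a l * q l) (∏ l, r l ^ q l) := by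
  change ∏ l, E.encHom pk (Multiplicative.ofAdd (a l), r l) ^ q l =
    E.encHom pk (Multiplicative.ofAdd (∑ l, a l * q l), ∏ l, r l ^ q l)
  simp_rw [← map_zpow, ← map_prod]
  congr 1
  refine Prod.ext ?_ ?_
  · rw [Prod.fst_prod, ofAdd_sum]
    refine Finset.prod_congr rfl fun l _ => ?_
    rw [Prod.pow_fst, ← ofAdd_zsmul, smul_eq_mul, mul_comm]
  · rw [Prod.snd_prod]
    rfl

/-- Entrywise encryption of arbitrary integers; `encShares` is the case of the shares of a party. -/
def encAll (pk : E.PK) (A : MatVec ℤ m n) (r : MatVec (E.Nonce pk) m n) :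
    MatVec (E.Cipher pk) m n :=
  (fun i j => E.enc pk (A.1 i j) (r.1 i j), fun j => E.enc pk (A.2 j) (r.2 j))

lemma entries_encAll (pk : E.PK) (A : MatVec ℤ m n) (r : MatVec (E.Nonce pk) m n)
    (e : Fin ((m + 1) * n)) :
    (E.encAll pk A r).entries e = E.enc pk (A.entries e) (r.entries e) := by
  simp only [MatVec.entries]
  generalize e.divNat = i
  induction i using Fin.lastCases <;> simp [encAll]

lemma mulRight_encAll (pk : E.PK) (A : MatVec ℤ m n) (r : MatVec (E.Nonce pk) m n)
    (Q : Matrix (Fin n) (Fin n) ℤ) :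
    E.mulRight pk (E.encAll pk A r) Q = E.encAll pk (A.mul Q) (r.zpowMul Q) :=
  Prod.ext (funext fun i => funext fun j => E.prod_enc_zpow pk (A.1 i) (r.1 i) fun l => Q l j)
    (funext fun j => E.prod_enc_zpow pk A.2 r.2 fun l => Q l j)

/-- The nonces of the ciphertexts in the second party's message. -/
def replyNonces (fresh : Bool) (pk : E.PK) (Q : Matrix (Fin n) (Fin n) ℤ)
    (r : MatVec (E.Nonce pk) m n) (s : E.Coins₂ pk m n) : MatVec (E.Nonce pk) m n :=
  if fresh then (r * s.1).zpowMul Q * s.2.2 else (r * s.1).zpowMul Q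

lemma reply_eq (fresh : Bool) (pk : E.PK) (x y : Input m n) (r : MatVec (E.Nonce pk) m n)
    (s : E.Coins₂ pk m n) :
    E.reply fresh pk y (E.encShares pk x r) s =
      E.encAll pk ((x.sum y).mul y.Q) (E.replyNonces fresh pk y.Q r s) := by
  have h : E.mulEntries pk (E.encShares pk x r) (E.encShares pk y s.1) =
      E.encAll pk (x.sum y) (r * s.1) :=
    Prod.ext (funext fun _ => funext fun _ => (E.enc_add _ _ _ _ _).symm)
      (funext fun _ => (E.enc_add _ _ _ _ _).symm)
  rw [reply, h, mulRight_encAll, replyNonces]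
  cases fresh
  · rfl
  · refine Prod.ext (funext fun _ => funext fun _ => ?_) (funext fun _ => ?_) <;>
      exact (E.enc_add _ _ _ _ _).symm.trans (by rw [add_zero]; rfl)

/-- The first party decrypts the transformed data. -/
lemma decrypted_reply (fresh : Bool) {k : ℕ} {key : E.PK × E.SK} (hkey : key ∈ (E.gen k).support)
    (x y : Input m n) (r : MatVec (E.Nonce key.1) m n) (s : E.Coins₂ key.1 m n) :
    E.decrypted key.1 key.2 x (E.reply fresh key.1 y (E.encShares key.1 x r) s) =
      (fun i j => ((x.transformed y).1 i j : ZMod (E.modulus key.1)),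
        fun j => ((x.transformed y).2 j : ZMod (E.modulus key.1))) := by
  rw [decrypted, reply_eq, mulRight_encAll, Input.transformed_eq]
  exact Prod.ext (funext fun _ => funext fun _ => E.dec_enc k key hkey _ _)
    (funext fun _ => E.dec_enc k key hkey _ _)

end AddHomEnc

/-! ### Monomial matrices -/

namespace IsMonomial

variable {m n : ℕ} {Q : Matrix (Fin n) (Fin n) ℤ}

lemma exists_equiv (hQ : IsMonomial Q) :
    ∃ σ : Equiv.Perm (Fin n), ∀ l j, Q l j ≠ 0 ↔ l = σ j := by
  choose f hf hf' using hQ.1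
  choose g hg hg' using hQ.2
  exact ⟨⟨g, f, fun j => (hf' _ _ (hg j)).symm, fun i => (hg' _ _ (hf i)).symm⟩,
    fun l j => ⟨hg' j l, fun h => h ▸ hg j⟩⟩

lemma rows_mul (A : MatVec ℤ m n) {σ : Equiv.Perm (Fin n)} (hσ : ∀ l j, Q l j ≠ 0 ↔ l = σ j)
    (i : Fin (m + 1)) (j : Fin n) :
    (A.mul Q).rows i j = A.rows i (σ j) * Q (σ j) j := by
  rw [MatVec.rows_mul]
  refine Finset.sum_eq_single _ (fun l _ hl => ?_) (by simp)
  rw [not_ne_iff.1 (mt (hσ l j).1 hl), mul_zero]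

/-- The rows of `A` can be recovered from those of `A Q` by divisions that do not depend on the
positions of the nonzero entries of `Q`: division by zero being zero, all quotients but at most one
vanish. -/
lemma div_eq (hQ : IsMonomial Q) (A : MatVec ℤ m n) (l : Fin n) :
    ∃ j₀, ∀ i j, (A.mul Q).rows i j / Q l j = if j = j₀ then A.rows i l else 0 := by
  obtain ⟨σ, hσ⟩ := hQ.exists_equiv
  refine ⟨σ.symm l, fun i j => ?_⟩
  split_ifs with h
  · obtain rfl : σ j = l := by rw [h, Equiv.apply_symm_apply]
    rw [rows_mul A hσ, Int.mul_ediv_cancel _ ((hσ _ _).2 rfl)]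
  · have : Q l j = 0 := not_ne_iff.1 (mt (hσ l j).1 fun h' => h (by
      rw [h', Equiv.symm_apply_apply]))
    rw [this, Int.ediv_zero]

/-- With `2 * ℓ + 1` bits, the first simulator can compute the entries of `M Q₂` and `Cᵀ Q₂`. -/
lemma natAbs_rows_mul_lt {x y : Input m n} {ℓ : ℕ} (hQ : IsMonomial y.Q) (hx : x.HasBits ℓ)
    (hy : y.HasBits ℓ) (i : Fin (m + 1)) (j : Fin n) :
    (((x.sum y).mul y.Q).rows i j).natAbs < 2 ^ (2 * ℓ + 1) := by
  obtain ⟨σ, hσ⟩ := hQ.exists_equiv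
  rw [rows_mul _ hσ, Int.natAbs_mul]
  have h₁ : ((x.sum y).rows i (σ j)).natAbs < 2 ^ ℓ + 2 ^ ℓ := by
    induction i using Fin.lastCases with
    | last =>
      rw [MatVec.rows_last]
      exact (Int.natAbs_add_le _ _).trans_lt (Nat.add_lt_add (hx.2.1 _) (hy.2.1 _))
    | cast i =>
      rw [MatVec.rows_castSucc]
      exact (Int.natAbs_add_le _ _).trans_lt (Nat.add_lt_add (hx.1 _ _) (hy.1 _ _))
  calc _ < (2 ^ ℓ + 2 ^ ℓ) * 2 ^ ℓ := Nat.mul_lt_mul'' h₁ (hy.2.2 _ _)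
    _ = 2 ^ (2 * ℓ + 1) := by ring

/-- Raising to the powers given by a monomial matrix is injective when its nonzero entries are
coprime to the order of the group. -/
lemma zpowMul_injective {G : Type} [CommGroup G] [Fintype G] (hQ : IsMonomial Q)
    (hc : ∀ i j, Q i j ≠ 0 → (Q i j).natAbs.Coprime (Fintype.card G)) :
    Injective fun c : MatVec G m n => c.zpowMul Q := by
  obtain ⟨σ, hσ⟩ := hQ.exists_equiv
  have hprod : ∀ (f : Fin n → G) j, ∏ l, f l ^ Q l j = f (σ j) ^ Q (σ j) j := fun f j =>
    Finset.prod_eq_single _ (fun l _ hl => by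
      rw [not_ne_iff.1 (mt (hσ l j).1 hl), zpow_zero]) (by simp)
  have hinj : ∀ (f g : Fin n → G), (∀ j, ∏ l, f l ^ Q l j = ∏ l, g l ^ Q l j) → f = g := by
    intro f g h
    funext l
    obtain ⟨j, rfl⟩ := σ.surjective l
    have hj := h j
    rw [hprod, hprod, ← div_eq_one, ← div_zpow] at hj
    have h₁ := Int.natCast_dvd.1 (orderOf_dvd_iff_zpow_eq_one.2 hj)
    have h₂ := Nat.eq_one_of_dvd_coprimes (hc _ _ ((hσ _ j).2 rfl)) h₁ orderOf_dvd_card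
    exact div_eq_one.1 (orderOf_eq_one_iff.1 h₂)
  intro c d h
  refine Prod.ext (funext fun i => hinj _ _ fun j => ?_) (hinj _ _ fun j => ?_)
  · exact congrFun (congrFun (congrArg Prod.fst h) i) j
  · exact congrFun (congrArg Prod.snd h) j

end IsMonomial

/-! ### The view of the first party -/

/-- Whatever the nonces of the first party are, those in the message it receives are uniformly
random. In the refreshed variant this is due to the fresh encryptions of zero; otherwise the nonces
of the second party's shares are transformed by a bijection. -/
lemma AddHomEnc.map_replyNonces (E : AddHomEnc) {m n : ℕ} (fresh : Bool) (pk : E.PK)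
    {Q : Matrix (Fin n) (Fin n) ℤ} (hQ : IsMonomial Q)
    (hc : fresh = true ∨ ∀ i j, Q i j ≠ 0 → (Q i j).natAbs.Coprime (Fintype.card (E.Nonce pk)))
    (r : MatVec (E.Nonce pk) m n) :
    (PMF.uniformOfFintype (E.Coins₂ pk m n)).map (E.replyNonces fresh pk Q r) =
      PMF.uniformOfFintype (MatVec (E.Nonce pk) m n) := by
  cases fresh with
  | false =>
    have hc := hc.resolve_left (by simp)
    have hb : Bijective fun a : MatVec (E.Nonce pk) m n => (r * a).zpowMul Q :=
      Finite.injective_iff_bijective.1 ((hQ.zpowMul_injective hc).comp (mul_right_injective r))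
    have h := congrArg (PMF.map fun a => (r * a).zpowMul Q) (map_fst_uniformOfFintype
      (α := MatVec (E.Nonce pk) m n)
      (β := (Fin n → Fin n → E.Nonce pk) × MatVec (E.Nonce pk) m n))
    rw [PMF.map_comp, map_uniformOfFintype_of_bijective hb] at h
    exact h
  | true =>
    have hb : Bijective fun s : E.Coins₂ pk m n => (s.1, s.2.1, (r * s.1).zpowMul Q * s.2.2) := by
      refine Finite.injective_iff_bijective.1 fun s t h => ?_
      simp only [Prod.mk.injEq] at h
      obtain ⟨h₁, h₂, h₃⟩ := h
      rw [h₁] at h₃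
      exact Prod.ext h₁ (Prod.ext h₂ (mul_left_cancel h₃))
    have h := congrArg (PMF.map fun s => s.2.2) (map_uniformOfFintype_of_bijective hb)
    rw [PMF.map_comp] at h
    refine Eq.trans h ?_
    change PMF.map (Prod.snd ∘ Prod.snd) _ = _
    rw [← PMF.map_comp, map_snd_uniformOfFintype, map_snd_uniformOfFintype]

namespace Program

/-- From the input of the first party and the transformed data, compute the entries of `M Q₂` and
`Cᵀ Q₂`. With `N = (m + 1) * n`, the matrix `Q₁` is in the registers from `N` on and the transformed
data are in those from `N + n * n` on. The entry `(i, l)` is the sum over `j` of the quotients of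
the entries `(i, j)` of the data by the entries `(l, j)` of `Q₁`, division by zero yielding zero. -/
def divideOut (m n w : ℕ) : Program :=
  (List.range ((m + 1) * n)).flatMap fun e =>
    sumDiv w ((m + 1) * n + n * n + (m + 1) * n + e) ((m + 1) * n + n * n + e / n * n)
      ((m + 1) * n + e % n * n) n

/-- From `a` registers, `N` further registers and `N` plaintexts: keep the first `a` registers and
append fresh keys, `N` fresh nonces, and encryptions of the plaintexts with `N` other nonces, which
are discarded. -/
def encryptReply (a N : ℕ) : Program :=
  [.gen] ++ nonces (a + N + N) N ++ nonces (a + N + N) N ++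
    encs (a + N + N) (a + N) (a + N + N + 2 + N) N ++
    [.select (List.range' 0 a ++ List.range' (a + N + N) 2 ++ List.range' (a + N + N + 2) N ++
      List.range' (a + N + N + 2 + N + N) N)]

/-- The simulator of the view of the first party. -/
def simulator₁ (m n ℓ : ℕ) : Program :=
  divideOut m n (2 * ℓ + 1) ++ encryptReply ((m + 1) * n + n * n) ((m + 1) * n)

lemma cost_simulator₁_le (m n ℓ : ℕ) : cost (simulator₁ m n ℓ) ≤
    (m + 1) * n * (1 + n * (2 * (2 * ℓ + 1) + (3 * ((m + 1) * n) + n * n) + 4)) +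
      (6 * ((m + 1) * n) + n * n + 4) := by
  rw [simulator₁, cost_append]
  refine Nat.add_le_add (cost_flatMap_range_le fun e he => ?_) ?_
  · refine (cost_sumDiv_le _ _ _ _ _).trans ?_
    exact Nat.add_le_add_left (Nat.mul_le_mul_left _ (by omega)) _
  · simp only [encryptReply, cost_append]
    generalize (m + 1) * n = N
    have h₁ := cost_nonces_le (N + n * n + N + N) N
    have h₂ := cost_encs_le (N + n * n + N + N) (N + n * n + N) (N + n * n + N + N + 2 + N) N
    have h₃ : cost [.gen] = 1 := by simp [cost, Instr.cost]
    have h₄ : ∀ l, cost [.select l] = l.length + 1 := by simp [cost, Instr.cost]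
    rw [h₃, h₄]
    simp only [List.length_append, List.length_range']
    omega

end Program

namespace AddHomEnc

open Program

variable (E : AddHomEnc) (k : ℕ)

lemma run_gen (s : List ℤ) :
    E.run k [.gen] s = (E.gen k).map fun key => s ++ [code key.1, code key.2] := by
  rw [run_singleton, step]

lemma run_divideOut {m n ℓ : ℕ} {x y : Input m n} (hx : x.HasBits ℓ) (hy : y.HasBits ℓ)
    (hQx : IsMonomial x.Q) (hQy : IsMonomial y.Q) :
    E.run k (divideOut m n (2 * ℓ + 1)) (x.toList ++ MatVec.toList (x.transformed y)) =
      PMF.pure (x.toList ++ MatVec.toList (x.transformed y) ++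
        MatVec.toList ((x.sum y).mul y.Q)) := by
  have hlen : (x.toList ++ MatVec.toList (x.transformed y)).length =
      (m + 1) * n + n * n + (m + 1) * n := by
    rw [List.length_append, Input.length_toList, MatVec.length_toList]
  set A := (x.sum y).mul y.Q
  rw [divideOut, E.run_loop_append k
    (v := fun e => if h : e < (m + 1) * n then A.entries ⟨e, h⟩ else 0), MatVec.toList_eq_ofFn A,
    map_range_eq_ofFn]
  · simp
  intro e he t ht
  have hn : 0 < n := Nat.pos_of_ne_zero fun h => by simp [h] at he
  set i : Fin (m + 1) := Fin.divNat ⟨e, he⟩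
  set l : Fin n := Fin.modNat ⟨e, he⟩
  have hi' : e / n = i := rfl
  have hl' : e % n = l := rfl
  have hin : (i : ℕ) * n + n ≤ (m + 1) * n := by
    rw [← Nat.succ_mul]; exact Nat.mul_le_mul_right _ i.2
  have hln : (l : ℕ) * n + n ≤ n * n := by
    rw [← Nat.succ_mul]; exact Nat.mul_le_mul_right _ l.2
  have hnum : ∀ j : Fin n, reg (x.toList ++ MatVec.toList (x.transformed y) ++ t)
      ((m + 1) * n + n * n + i * n + j) = (A.mul x.Q).rows i j := fun j => by
    have hj := j.2
    rw [reg_append_left (by omega), add_assoc, ← Input.length_toList x, reg_append_right,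
      MatVec.toList_eq_matList, reg_matList, Input.transformed_eq]
  have hden : ∀ j : Fin n, reg (x.toList ++ MatVec.toList (x.transformed y) ++ t)
      ((m + 1) * n + l * n + j) = x.Q l j := fun j => by
    have hj := j.2
    rw [reg_append_left (by omega), reg_append_left (by rw [Input.length_toList]; omega),
      Input.toList, add_assoc, ← MatVec.length_toList (x.M, x.C), reg_append_right]
    exact reg_matList (m := n) x.Q l j
  rw [hi', hl']
  -- at most one quotient is nonzero, so that the partial sums do not exceed the word length
  obtain ⟨j₀, hj₀⟩ := hQx.div_eq A l
  have hquot : ∀ j < n, reg (x.toList ++ MatVec.toList (x.transformed y) ++ t)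
      ((m + 1) * n + n * n + i * n + j) / reg (x.toList ++ MatVec.toList (x.transformed y) ++ t)
      ((m + 1) * n + l * n + j) = if j = j₀ then A.rows i l else 0 := fun j hj => by
    have h₁ := hnum ⟨j, hj⟩
    have h₂ := hden ⟨j, hj⟩
    simp only at h₁ h₂
    rw [h₁, h₂, hj₀]
    simp only [Fin.ext_iff]
  have hsum : ∀ j ≤ n, ∑ l' ∈ Finset.range j,
      reg (x.toList ++ MatVec.toList (x.transformed y) ++ t)
      ((m + 1) * n + n * n + i * n + l') / reg (x.toList ++ MatVec.toList (x.transformed y) ++ t)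
      ((m + 1) * n + l * n + l') = if ↑j₀ < j then A.rows i l else 0 := fun j hj => by
    rw [Finset.sum_congr rfl fun l' hl' => hquot l' ((Finset.mem_range.1 hl').trans_le hj),
      Finset.sum_ite_eq']
    simp
  have hbound := hQy.natAbs_rows_mul_lt hx hy i l
  have hbound₀ : ∀ (p : Prop) [Decidable p],
      (if p then A.rows i l else 0).natAbs < 2 ^ (2 * ℓ + 1) := fun p _ => by
    split_ifs
    · exact hbound
    · simp
  rw [run_sumDiv, hsum n le_rfl, if_pos j₀.2, dif_pos he]
  · rfl
  · rw [List.length_append, hlen, ht]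
  · omega
  · omega
  · intro j hj
    rw [hquot j hj]
    exact hbound₀ _
  · intro j hj
    rw [hsum j hj]
    exact hbound₀ _

lemma run_encryptReply {X T : List ℤ} {a N : ℕ} (hX : X.length = a) (hT : T.length = N)
    (v : Fin N → ℤ) :
    E.run k (encryptReply a N) (X ++ T ++ List.ofFn v) = (E.gen k).bind fun key =>
      (PMF.uniformOfFintype (Fin N → E.Nonce key.1)).bind fun r =>
        (PMF.uniformOfFintype (Fin N → E.Nonce key.1)).map fun s =>
          X ++ [code key.1, code key.2] ++ (List.ofFn fun e => code (r e)) ++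
            List.ofFn fun e => code (E.enc key.1 (v e) (s e)) := by
  have hpk : ∀ pk sk t, reg (X ++ T ++ List.ofFn v ++ [pk, sk] ++ t) (a + N + N) = pk := by
    intro pk sk t
    exact reg_of_eq_append (i := 0) (B := [pk, sk]) rfl (by simp [hX, hT, add_assoc]) (by simp)
  simp only [encryptReply, run_append, run_gen, PMF.bind_map, PMF.bind_bind]
  congr 1
  funext key
  have hpk₀ := hpk (code key.1) (code key.2) []
  rw [List.append_nil] at hpk₀
  simp only [comp_apply]
  rw [E.run_nonces k (by simp; omega) hpk₀, PMF.bind_map]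
  congr 1
  funext r
  simp only [comp_apply]
  rw [E.run_nonces k (by simp; omega) (hpk _ _ _), PMF.bind_map, ← PMF.bind_pure_comp]
  congr 1
  funext s
  simp only [comp_apply]
  rw [E.run_encs k (A := X ++ T) (v := v)
    (A' := X ++ T ++ List.ofFn v ++ [code key.1, code key.2] ++
      List.ofFn fun e => code (r e)) (r := s) (C' := []) (by simp; omega)
    (by rw [List.append_assoc _ (List.ofFn _)]; exact hpk _ _ _)
    (by simp only [List.append_assoc]; rfl) (by simp [hX, hT]) (by simp) (by simp [hX, hT]; omega),
    PMF.pure_bind, run_select, List.map_append, List.map_append, List.map_append,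
    map_reg_range' (p := 0) (A := []) (B := X) (by simp only [List.append_assoc]; rfl) rfl hX.symm,
    map_reg_range' (q := 2) (A := X ++ T ++ List.ofFn v) (B := [code key.1, code key.2])
      (by simp only [List.append_assoc]; rfl) (by simp [hX, hT, add_assoc]) rfl,
    map_reg_range' (A := X ++ T ++ List.ofFn v ++ [code key.1, code key.2])
      (B := List.ofFn fun e => code (r e))
      (by simp only [List.append_assoc]; rfl) (by simp [hX, hT, add_assoc]) (by simp),
    map_reg_range' (A := X ++ T ++ List.ofFn v ++ [code key.1, code key.2] ++
      (List.ofFn fun e => code (r e)) ++ List.ofFn fun e => code (s e)) (C := [])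
      (B := List.ofFn fun e => code (E.enc key.1 (v e) (s e)))
      (by simp) (by simp [hX, hT]; omega) (by simp)]

lemma codes_eq_ofFn {α : Type} [Encodable α] {m n : ℕ} (c : MatVec α m n) :
    codes c = List.ofFn fun e => code (c.entries e) := by
  rw [codes, MatVec.toList_eq_ofFn, List.map_ofFn]
  rfl

/-- The simulator outputs exactly the distribution of the view of the first party. -/
lemma run_simulator₁ (fresh : Bool) {m n ℓ : ℕ} {x y : Input m n} (hx : x.HasBits ℓ)
    (hy : y.HasBits ℓ) (hQx : IsMonomial x.Q) (hQy : IsMonomial y.Q)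
    (hc : fresh = true ∨ E.CoprimeToNonces k y.Q) :
    E.run k (simulator₁ m n ℓ) (x.toList ++ MatVec.toList (x.transformed y)) =
      E.view₁ fresh k x y := by
  rw [simulator₁, run_append, E.run_divideOut k hx hy hQx hQy, PMF.pure_bind,
    MatVec.toList_eq_ofFn ((x.sum y).mul y.Q),
    E.run_encryptReply k (Input.length_toList x) (MatVec.length_toList _), view₁]
  refine bind_congr_of_mem_support _ fun key hkey => ?_
  rw [← map_uniformOfFintype_of_bijective (MatVec.entries_bijective (α := E.Nonce key.1)
    (m := m) (n := n)), PMF.bind_map]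
  congr 1
  funext r
  have h := E.map_replyNonces (m := m) fresh key.1 hQy (hc.imp_right fun h => h key hkey) r
  rw [← h, comp_apply, PMF.map_comp, PMF.map_comp]
  congr 1
  funext s
  simp only [comp_apply, reply_eq, codes_eq_ofFn, entries_encAll]

end AddHomEnc

/-! ### The view of the second party and the hybrid argument -/

namespace Program

/-- When there are `b` registers and a public key in register `i`: append `K` nonces, the plaintexts
`v`, nonces for them, and their encryptions. -/
def encryptConsts (i b K : ℕ) (v : List ℤ) : Program :=
  nonces i K ++ consts v ++ nonces i v.length ++ encs i (b + K) (b + K + v.length) v.length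

/-- The simulator of the view of the second party, whose input has `a` entries and which uses `K`
nonces. The `N` ciphertexts that it receives are replaced by encryptions of zero. -/
def simulator₂ (a K N : ℕ) : Program :=
  [.gen] ++ encryptConsts a (a + 2) K (List.replicate N 0) ++
    [.select (List.range' 0 a ++ List.range' (a + 2) K ++ [a] ++
      List.range' (a + 2 + K + N + N) N)]

/-- The reduction of the hybrid argument: from a public key and a ciphertext, compute a view of the
second party with input `Y` in which the ciphertext number `j` is the given one, while the other
ones are fresh encryptions of the entries of `v`. -/
def reduction (Y : List ℤ) (K : ℕ) (v : List ℤ) (j : ℕ) : Program :=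
  consts Y ++ encryptConsts 0 (Y.length + 2) K v ++
    [.select (List.range' 2 Y.length ++ List.range' (Y.length + 2) K ++ [0] ++
      (List.range' (Y.length + 2 + K + v.length + v.length) v.length).set j 1)]

lemma cost_encryptConsts_le (i b K : ℕ) {v : List ℤ} {ℓ : ℕ} (hv : ∀ a ∈ v, a.natAbs < 2 ^ ℓ) :
    cost (encryptConsts i b K v) ≤ K + v.length * (ℓ + 1) + v.length + v.length := by
  simp only [encryptConsts, cost_append]
  gcongr
  · exact cost_nonces_le _ _
  · exact cost_consts_le hv
  · exact cost_nonces_le _ _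
  · exact cost_encs_le _ _ _ _

lemma cost_simulator₂_le (a K N : ℕ) : cost (simulator₂ a K N) ≤ a + 2 * K + 4 * N + 3 := by
  have h := cost_encryptConsts_le a (a + 2) K (v := List.replicate N 0) (ℓ := 0) (by simp)
  have h₁ : cost [.gen] = 1 := by simp [cost, Instr.cost]
  have h₂ : ∀ l, cost [.select l] = l.length + 1 := by simp [cost, Instr.cost]
  simp only [simulator₂, cost_append, h₁, h₂, List.length_append, List.length_range',
    List.length_replicate, List.length_singleton] at h ⊢
  omega

lemma cost_reduction_le {Y : List ℤ} (K : ℕ) {v : List ℤ} (j : ℕ) {ℓ : ℕ}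
    (hY : ∀ a ∈ Y, a.natAbs < 2 ^ ℓ) (hv : ∀ a ∈ v, a.natAbs < 2 ^ ℓ) :
    cost (reduction Y K v j) ≤
      Y.length * (ℓ + 1) + Y.length + v.length * (ℓ + 1) + 3 * v.length + 2 * K + 2 := by
  have h := cost_encryptConsts_le 0 (Y.length + 2) K hv
  have h₁ := cost_consts_le hY
  have h₂ : ∀ l, cost [.select l] = l.length + 1 := by simp [cost, Instr.cost]
  simp only [reduction, cost_append, h₂, List.length_append, List.length_range',
    List.length_set, List.length_singleton]
  omega

end Program

namespace AddHomEnc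

open Program

variable (E : AddHomEnc) (k : ℕ)

lemma run_encryptConsts {s : List ℤ} {pk : E.PK} {i b K N : ℕ} (hi : i < s.length)
    (hpk : reg s i = code pk) (hb : b = s.length) (v : Fin N → ℤ) :
    E.run k (encryptConsts i b K (List.ofFn v)) s =
      (PMF.uniformOfFintype (Fin K → E.Nonce pk)).bind fun t =>
        (PMF.uniformOfFintype (Fin N → E.Nonce pk)).map fun r =>
          s ++ (List.ofFn fun e => code (t e)) ++ List.ofFn v ++ (List.ofFn fun e => code (r e)) ++
            List.ofFn fun e => code (E.enc pk (v e) (r e)) := by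
  have hpk' : ∀ t, reg (s ++ t) i = code pk := fun t => by rw [reg_append_left hi, hpk]
  simp only [encryptConsts, run_append, E.run_nonces k hi hpk, PMF.bind_map, PMF.bind_bind,
    List.length_ofFn]
  congr 1
  funext t
  simp only [comp_apply]
  rw [run_consts, PMF.pure_bind, E.run_nonces k (by simp; omega)
    (by rw [List.append_assoc]; exact hpk' _), PMF.bind_map, ← PMF.bind_pure_comp]
  congr 1
  funext r
  simp only [comp_apply]
  rw [E.run_encs k (A := s ++ List.ofFn fun e => code (t e)) (v := v)
    (A' := s ++ (List.ofFn fun e => code (t e)) ++ List.ofFn v) (r := r) (C' := [])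
    (by simp; omega) (by simp only [List.append_assoc]; exact hpk' _)
    (by simp only [List.append_assoc]; rfl) (by simp [hb]) (by simp) (by simp [hb, add_assoc])]

/-- A public key and `N` encryptions of the entries of `v` under it, together with the fixed values
`Y` and `K` further nonces, in the format of a view of the second party. -/
def hybrid (Y : List ℤ) (K : ℕ) {N : ℕ} (v : Fin N → ℤ) : PMF (List ℤ) :=
  (E.gen k).bind fun key =>
    (PMF.uniformOfFintype (Fin K → E.Nonce key.1)).bind fun t =>
      (PMF.uniformOfFintype (Fin N → E.Nonce key.1)).map fun r =>
        Y ++ (List.ofFn fun e => code (t e)) ++ [code key.1] ++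
          List.ofFn fun e => code (E.enc key.1 (v e) (r e))

lemma run_simulator₂ (Y : List ℤ) (K N : ℕ) :
    E.run k (simulator₂ Y.length K N) Y = E.hybrid k Y K fun _ : Fin N => 0 := by
  rw [simulator₂, hybrid, run_append, run_append, run_gen, PMF.bind_map, PMF.bind_bind]
  congr 1
  funext key
  rw [← List.ofFn_const N (0 : ℤ), comp_apply, E.run_encryptConsts k (pk := key.1)
    (by simp) (by simp [reg]) (by simp), PMF.bind_bind]
  congr 1
  funext t
  rw [PMF.bind_map, ← PMF.bind_pure_comp]
  congr 1
  funext r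
  simp only [comp_apply]
  rw [run_select]
  simp only [List.map_append, List.map_singleton]
  rw [map_reg_range' (p := 0) (A := []) (B := Y) (by simp only [List.append_assoc]; rfl) rfl rfl,
    map_reg_range' (A := Y ++ [code key.1, code key.2]) (B := List.ofFn fun e => code (t e))
      (by simp only [List.append_assoc]; rfl) (by simp) (by simp),
    map_reg_range' (A := Y ++ [code key.1, code key.2] ++ (List.ofFn fun e => code (t e)) ++
      (List.ofFn fun _ : Fin N => 0) ++ List.ofFn fun e => code (r e)) (C := [])
      (B := List.ofFn fun e => code (E.enc key.1 0 (r e)))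
      (by simp) (by simp; omega) (by simp)]
  simp [reg]

lemma run_reduction (Y : List ℤ) (K : ℕ) {N : ℕ} (v : Fin N → ℤ) (j : Fin N) (a : ℤ) :
    (E.encryption k a).bind (E.run k (reduction Y K (List.ofFn v) j)) =
      E.hybrid k Y K (update v j a) := by
  rw [encryption, hybrid, PMF.bind_bind]
  congr 1
  funext key
  rw [PMF.bind_map]
  have h : ∀ r₀, E.run k (reduction Y K (List.ofFn v) j) [code key.1, code (E.enc key.1 a r₀)] =
      (PMF.uniformOfFintype (Fin K → E.Nonce key.1)).bind fun t =>
        (PMF.uniformOfFintype (Fin N → E.Nonce key.1)).map fun r =>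
          Y ++ (List.ofFn fun e => code (t e)) ++ [code key.1] ++
            List.ofFn fun e => code (E.enc key.1 (update v j a e) (update r j r₀ e)) := by
    intro r₀
    rw [reduction, run_append, run_append, run_consts, PMF.pure_bind,
      E.run_encryptConsts k (pk := key.1) (by simp) (by simp [reg]) (by simp), PMF.bind_bind]
    congr 1
    funext t
    rw [PMF.bind_map, ← PMF.bind_pure_comp]
    congr 1
    funext r
    simp only [comp_apply, List.length_ofFn]
    rw [run_select]
    simp only [List.map_append, List.map_singleton, List.map_set]
    rw [map_reg_range' (p := 2) (A := [code key.1, code (E.enc key.1 a r₀)]) (B := Y)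
        (by simp only [List.append_assoc]; rfl) rfl rfl,
      map_reg_range' (A := [code key.1, code (E.enc key.1 a r₀)] ++ Y)
        (B := List.ofFn fun e => code (t e))
        (by simp only [List.append_assoc]; rfl) (by simp) (by simp),
      map_reg_range' (A := [code key.1, code (E.enc key.1 a r₀)] ++ Y ++
        (List.ofFn fun e => code (t e)) ++ List.ofFn v ++ List.ofFn fun e => code (r e)) (C := [])
        (B := List.ofFn fun e => code (E.enc key.1 (v e) (r e)))
        (by simp) (by simp; omega) (by simp), set_ofFn]
    have hu : update (fun e => code (E.enc key.1 (v e) (r e))) j (code (E.enc key.1 a r₀)) =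
        fun e => code (E.enc key.1 (update v j a e) (update r j r₀ e)) := by
      funext e
      rcases eq_or_ne e j with rfl | he
      · simp
      · simp [he]
    simp only [← hu]
    simp [reg]
  refine (congrArg _ (funext h)).trans ?_
  rw [PMF.bind_comm]
  congr 1
  funext t
  exact uniformOfFintype_bind_update j fun r => Y ++ (List.ofFn fun e => code (t e)) ++
    [code key.1] ++ List.ofFn fun e => code (E.enc key.1 (update v j a e) (r e))

lemma acceptProb_append (P D : Program) (μ : PMF (List ℤ)) :
    E.acceptProb k (P ++ D) μ = E.acceptProb k D (μ.bind (E.run k P)) := by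
  rw [acceptProb, acceptProb, PMF.bind_bind, funext (E.run_append k P D)]

/-- The hybrid argument: a test of the view against its simulation yields, for one of the `N`
ciphertexts, a test of encryptions with at least the `N`-th part of the advantage. -/
lemma exists_reduction (D : Program) {Y : List ℤ} (K : ℕ) {N ℓ : ℕ} {v : Fin N → ℤ}
    (hY : ∀ a ∈ Y, a.natAbs < 2 ^ ℓ) (hv : ∀ e, (v e).natAbs < 2 ^ ℓ) :
    ∃ (R : Program) (a : ℤ),
      R.cost ≤ Y.length * (ℓ + 1) + Y.length + N * (ℓ + 1) + 3 * N + 2 * K + 2 ∧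
      a.natAbs < 2 ^ ℓ ∧
      |E.acceptProb k D (E.hybrid k Y K fun _ : Fin N => 0) -
        E.acceptProb k D (E.hybrid k Y K v)| ≤
      N * |E.acceptProb k (R ++ D) (E.encryption k a) -
        E.acceptProb k (R ++ D) (E.encryption k 0)| := by
  -- in the hybrid number `j`, the first `j` ciphertexts are those of the view
  let h : ℕ → Fin N → ℤ := fun j e => if (e : ℕ) < j then v e else 0
  let f : ℕ → ℝ := fun j => E.acceptProb k D (E.hybrid k Y K (h j))
  have hf₀ : f 0 = E.acceptProb k D (E.hybrid k Y K fun _ : Fin N => 0) := by simp [f, h]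
  have hfN : f N = E.acceptProb k D (E.hybrid k Y K v) := by simp [f, h]
  have hsum : |f 0 - f N| ≤ ∑ j ∈ Finset.range N, |f j - f (j + 1)| := by
    simpa only [Real.dist_eq] using dist_le_range_sum_dist f N
  rw [← hf₀, ← hfN]
  rcases Nat.eq_zero_or_pos N with rfl | hN
  · exact ⟨[], 0, by simp [Program.cost], by simp, by simp⟩
  obtain ⟨j, hj, hmax⟩ := Finset.exists_max_image (Finset.range N) (fun j => |f j - f (j + 1)|)
    ⟨0, by simpa using hN⟩
  rw [Finset.mem_range] at hj
  have hh : ∀ j, ∀ a ∈ List.ofFn (h j), a.natAbs < 2 ^ ℓ := by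
    intro j a ha
    obtain ⟨e, rfl⟩ := (List.mem_ofFn' _ _).1 ha
    simp only [h]
    split_ifs
    · exact hv e
    · simp
  refine ⟨reduction Y K (List.ofFn (h j)) j, v ⟨j, hj⟩, ?_, hv _, ?_⟩
  · simpa using cost_reduction_le K j hY (hh j)
  · have h₁ : update (h j) ⟨j, hj⟩ (v ⟨j, hj⟩) = h (j + 1) := by
      funext e
      rcases eq_or_ne e ⟨j, hj⟩ with rfl | he
      · simp [h]
      · have : (e : ℕ) ≠ j := fun h' => he (Fin.ext h')
        have : (e : ℕ) < j + 1 ↔ (e : ℕ) < j := by omega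
        simp [h, he, this]
    -- the hybrid number `j` has a zero at the position `j` already
    have h₂ : update (h j) ⟨j, hj⟩ 0 = h j := by
      rw [update_eq_self_iff]
      simp [h]
    have e₁ := E.run_reduction k Y K (h j) ⟨j, hj⟩ (v ⟨j, hj⟩)
    have e₂ := E.run_reduction k Y K (h j) ⟨j, hj⟩ 0
    rw [acceptProb_append, acceptProb_append, e₁, e₂, h₁, h₂]
    refine hsum.trans ((Finset.sum_le_card_nsmul _ _ _ hmax).trans ?_)
    rw [Finset.card_range, nsmul_eq_mul, abs_sub_comm (f j)]

/-- The distribution of the representations of `K` independent nonces. -/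
def nonceList (pk : E.PK) (K : ℕ) : PMF (List ℤ) :=
  (PMF.uniformOfFintype (Fin K → E.Nonce pk)).map fun t => List.ofFn fun e => code (t e)

lemma nonceList_add (pk : E.PK) (K L : ℕ) :
    E.nonceList pk (K + L) =
      (E.nonceList pk K).bind fun l => (E.nonceList pk L).map fun l' => l ++ l' := by
  rw [nonceList, ← map_uniformOfFintype_of_bijective (Fin.appendEquiv K L).bijective,
    uniformOfFintype_prod, PMF.map_bind, PMF.map_bind, nonceList, PMF.bind_map]
  congr 1
  funext t
  rw [PMF.map_comp, PMF.map_comp, nonceList, comp_apply, PMF.map_comp]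
  congr 1
  funext t'
  simp only [comp_apply]
  rw [← List.ofFn_fin_append]
  congr 1
  funext e
  induction e using Fin.addCases <;> simp [Fin.appendEquiv]

lemma map_codes_uniformOfFintype (pk : E.PK) (m n : ℕ) :
    (PMF.uniformOfFintype (MatVec (E.Nonce pk) m n)).map codes =
      E.nonceList pk ((m + 1) * n) := by
  rw [nonceList, ← map_uniformOfFintype_of_bijective MatVec.entries_bijective, PMF.map_comp]
  congr 1
  funext c
  exact codes_eq_ofFn c

lemma map_matList_uniformOfFintype (pk : E.PK) (m n : ℕ) :
    (PMF.uniformOfFintype (Fin m → Fin n → E.Nonce pk)).map (fun A => (matList A).map code) =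
      E.nonceList pk (m * n) := by
  have hb := ((Equiv.curry (Fin m) (Fin n) (E.Nonce pk)).symm.trans
    (finProdFinEquiv.arrowCongr (Equiv.refl _))).bijective
  rw [nonceList, ← map_uniformOfFintype_of_bijective hb, PMF.map_comp]
  congr 1
  funext A
  rw [matList_eq_ofFn, List.map_ofFn]
  rfl

/-- The number of nonces in the view of the second party. -/
def nonceCount (fresh : Bool) (m n : ℕ) : ℕ :=
  (m + 1) * n + n * n + if fresh then (m + 1) * n else 0

lemma map_coins_uniformOfFintype (fresh : Bool) (pk : E.PK) (m n : ℕ) :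
    (PMF.uniformOfFintype (E.Coins₂ pk m n)).map (fun s =>
      codes s.1 ++ (matList s.2.1).map code ++ if fresh then codes s.2.2 else []) =
      E.nonceList pk (nonceCount fresh m n) := by
  have hAB : E.nonceList pk ((m + 1) * n + n * n) =
      (PMF.uniformOfFintype (MatVec (E.Nonce pk) m n)).bind fun a =>
        (PMF.uniformOfFintype (Fin n → Fin n → E.Nonce pk)).map fun b =>
          codes a ++ (matList b).map code := by
    rw [nonceList_add, ← map_codes_uniformOfFintype, ← map_matList_uniformOfFintype, PMF.bind_map]
    congr 1
    funext a
    rw [comp_apply, PMF.map_comp]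
    rfl
  cases fresh with
  | false =>
    simp only [nonceCount, Bool.false_eq_true, if_false, List.append_nil, add_zero]
    rw [hAB, uniformOfFintype_prod, PMF.map_bind]
    congr 1
    funext a
    rw [PMF.map_comp]
    change PMF.map ((fun b => codes a ++ (matList b).map code) ∘ Prod.fst) _ = _
    rw [← PMF.map_comp, map_fst_uniformOfFintype]
  | true =>
    simp only [nonceCount, if_true]
    rw [nonceList_add, hAB, uniformOfFintype_prod, PMF.map_bind, PMF.bind_bind]
    congr 1
    funext a
    rw [PMF.map_comp, uniformOfFintype_prod, PMF.map_bind, PMF.bind_map]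
    congr 1
    funext b
    rw [PMF.map_comp, ← map_codes_uniformOfFintype, comp_apply, PMF.map_comp]
    rfl

lemma view₂_eq_hybrid (fresh : Bool) {m n : ℕ} (x y : Input m n) :
    E.view₂ fresh k x y =
      E.hybrid k y.toList (nonceCount fresh m n) (MatVec.entries (x.M, x.C)) := by
  rw [view₂, hybrid]
  congr 1
  funext key
  have h₁ := congrArg (fun p => p.bind fun l =>
    (PMF.uniformOfFintype (Fin ((m + 1) * n) → E.Nonce key.1)).map fun r =>
        y.toList ++ l ++ [code key.1] ++
          List.ofFn fun e => code (E.enc key.1 (MatVec.entries (x.M, x.C) e) (r e)))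
    (E.map_coins_uniformOfFintype fresh key.1 m n)
  simp only [nonceList, PMF.bind_map] at h₁
  refine Eq.trans ?_ h₁
  simp only [← PMF.bind_pure_comp]
  rw [PMF.bind_comm]
  congr 1
  funext s
  rw [← map_uniformOfFintype_of_bijective MatVec.entries_bijective, comp_apply, PMF.bind_map]
  congr 1
  funext r
  simp only [comp_apply, codes_eq_ofFn (E.encShares key.1 x r)]
  congr 2
  refine congrArg List.ofFn (funext fun e => congrArg code ?_)
  exact E.entries_encAll key.1 (x.M, x.C) r e

end AddHomEnc

namespace Input

lemma natAbs_entries_lt {m n ℓ : ℕ} {x : Input m n} (hx : x.HasBits ℓ) (e : Fin ((m + 1) * n)) :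
    (MatVec.entries (x.M, x.C) e).natAbs < 2 ^ ℓ := by
  rw [MatVec.entries]
  generalize e.divNat = i
  induction i using Fin.lastCases with
  | last => rw [MatVec.rows_last]; exact hx.2.1 _
  | cast i => rw [MatVec.rows_castSucc]; exact hx.1 _ _

lemma natAbs_lt_of_mem_toList {m n ℓ : ℕ} {x : Input m n} (hx : x.HasBits ℓ) :
    ∀ a ∈ x.toList, a.natAbs < 2 ^ ℓ := by
  intro a ha
  rw [Input.toList, List.mem_append] at ha
  rcases ha with ha | ha
  · rw [MatVec.toList_eq_ofFn] at ha
    obtain ⟨e, rfl⟩ := (List.mem_ofFn' _ _).1 ha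
    exact natAbs_entries_lt hx e
  · rw [matList_eq_ofFn (m := n) x.Q] at ha
    obtain ⟨e, rfl⟩ := (List.mem_ofFn' _ _).1 ha
    exact hx.2.2 _ _

end Input

/-! ### Polynomial bounds and negligible functions -/

lemma PolyBounded.mono {f g : ℕ → ℕ} (hg : PolyBounded g) (h : ∀ k, f k ≤ g k) :
    PolyBounded f :=
  hg.imp fun _ hp k => (h k).trans (hp k)

lemma polyBounded_const (c : ℕ) : PolyBounded fun _ => c := ⟨Polynomial.C c, by simp⟩

lemma PolyBounded.add {f g : ℕ → ℕ} (hf : PolyBounded f) (hg : PolyBounded g) :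
    PolyBounded fun k => f k + g k := by
  obtain ⟨p, hp⟩ := hf
  obtain ⟨q, hq⟩ := hg
  exact ⟨p + q, fun k => by simpa using Nat.add_le_add (hp k) (hq k)⟩

lemma PolyBounded.mul {f g : ℕ → ℕ} (hf : PolyBounded f) (hg : PolyBounded g) :
    PolyBounded fun k => f k * g k := by
  obtain ⟨p, hp⟩ := hf
  obtain ⟨q, hq⟩ := hg
  exact ⟨p * q, fun k => by simpa using Nat.mul_le_mul (hp k) (hq k)⟩

lemma polyBounded_nonceCount (fresh : Bool) {m n : ℕ → ℕ} (hm : PolyBounded m)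
    (hn : PolyBounded n) : PolyBounded fun k => AddHomEnc.nonceCount fresh (m k) (n k) :=
  ((((hm.add (polyBounded_const 1)).mul hn).add (hn.mul hn)).add
    ((hm.add (polyBounded_const 1)).mul hn)).mono fun k => by
      rw [AddHomEnc.nonceCount]
      split_ifs <;> omega

lemma Negligible.polyBounded_mul {f g : ℕ → ℝ} {N : ℕ → ℕ} (hf : Negligible f)
    (hN : PolyBounded N) (h : ∀ k, |g k| ≤ N k * |f k|) : Negligible g := by
  obtain ⟨p, hp⟩ := hN
  refine (Asymptotics.SuperpolynomialDecay.polynomial_mul hf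
    (p.map (Nat.castRingHom ℝ))).trans_abs_le fun k => (h k).trans ?_
  rw [Polynomial.eval_natCast_map, abs_mul]
  refine mul_le_mul_of_nonneg_right ?_ (abs_nonneg _)
  simpa using hp k

end SecureLP

end

theorem theorem1 (E : AddHomEnc) (hE : E.SemanticallySecure) (fresh : Bool)
    (m n ℓ : ℕ → ℕ) (hm : PolyBounded m) (hn : PolyBounded n) (hℓ : PolyBounded ℓ) :
    -- the first party obtains the transformed data
    (∀ (k : ℕ) (x y : Input (m k) (n k)), ∀ key ∈ (E.gen k).support,
      ∀ (r : MatVec (E.Nonce key.1) (m k) (n k)) (s : E.Coins₂ key.1 (m k) (n k)),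
      let out := E.decrypted key.1 key.2 x (E.reply fresh key.1 y (E.encShares key.1 x r) s)
      let val := x.transformed y
      (∀ i j, out.1 i j = (val.1 i j : ZMod (E.modulus key.1)) ∧
        (2 * (val.1 i j).natAbs < E.modulus key.1 → (out.1 i j).valMinAbs = val.1 i j)) ∧
      (∀ j, out.2 j = (val.2 j : ZMod (E.modulus key.1)) ∧
        (2 * (val.2 j).natAbs < E.modulus key.1 → (out.2 j).valMinAbs = val.2 j))) ∧
    -- and learns nothing else
    (∃ S : ℕ → Program, PolyBounded (fun k => (S k).cost) ∧
      ∀ (k : ℕ) (x y : Input (m k) (n k)), x.HasBits (ℓ k) → y.HasBits (ℓ k) →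
        IsMonomial x.Q → IsMonomial y.Q →
        (fresh = true ∨ E.CoprimeToNonces k y.Q) →
        E.run k (S k) (x.toList ++ MatVec.toList (x.transformed y)) = E.view₁ fresh k x y) ∧
    -- and the second party learns nothing
    (∃ S : ℕ → Program, PolyBounded (fun k => (S k).cost) ∧
      ∀ x y : ∀ k, Input (m k) (n k), (∀ k, (x k).HasBits (ℓ k)) → (∀ k, (y k).HasBits (ℓ k)) →
        E.Indistinguishable (fun k => E.run k (S k) (y k).toList)
          (fun k => E.view₂ fresh k (x k) (y k))) := by
  have hN : PolyBounded fun k => (m k + 1) * n k := (hm.add (polyBounded_const 1)).mul hn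
  have hn₂ := hn.mul hn
  have hK := polyBounded_nonceCount fresh hm hn
  have hc := polyBounded_const
  refine ⟨fun k x y key hkey r s => ?_,
    ⟨fun k => Program.simulator₁ (m k) (n k) (ℓ k), ?_, fun k x y hx hy hQx hQy hcop =>
      E.run_simulator₁ k fresh hx hy hQx hQy hcop⟩,
    ⟨fun k => Program.simulator₂ ((m k + 1) * n k + n k * n k)
      (AddHomEnc.nonceCount fresh (m k) (n k)) ((m k + 1) * n k), ?_, fun x y hx hy D hD => ?_⟩⟩
  · rw [E.decrypted_reply fresh hkey x y r s]
    exact ⟨fun i j => ⟨rfl, valMinAbs_intCast (E.modulus_pos _)⟩,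
      fun j => ⟨rfl, valMinAbs_intCast (E.modulus_pos _)⟩⟩
  · have h₁ := (hc 1).add (hn.mul ((((hc 2).mul (((hc 2).mul hℓ).add (hc 1))).add
      (((hc 3).mul hN).add hn₂)).add (hc 4)))
    have h₂ := (((hc 6).mul hN).add hn₂).add (hc 4)
    exact ((hN.mul h₁).add h₂).mono fun k => Program.cost_simulator₁_le _ _ _
  · exact ((((hN.add hn₂).add ((hc 2).mul hK)).add ((hc 4).mul hN)).add (hc 3)).mono fun k =>
      Program.cost_simulator₂_le _ _ _
  · choose R a hR ha hadv using fun k => E.exists_reduction k (D k)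
      (AddHomEnc.nonceCount fresh (m k) (n k)) (Input.natAbs_lt_of_mem_toList (hy k))
      (Input.natAbs_entries_lt (hx k))
    have hRpoly : PolyBounded fun k => (R k).cost := by
      have hY := hN.add hn₂
      refine (((((hY.mul (hℓ.add (hc 1))).add hY).add (hN.mul (hℓ.add (hc 1)))).add
        ((hc 3).mul hN)).add (((hc 2).mul hK).add (hc 2))).mono fun k => (hR k).trans ?_
      rw [Input.length_toList, add_assoc (_ + _ + _ + _) (2 * _) 2]
    have hsec := hE a (fun _ => 0) (hℓ.mono fun k => Nat.size_le.2 (ha k)) (by simpa using hc 0)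
      (fun k => R k ++ D k) (by simpa only [Program.cost_append] using hRpoly.add hD)
    -- the number of ciphertexts is the factor that the hybrid argument loses
    refine hsec.polyBounded_mul hN fun k => ?_
    simp only [abs_abs]
    rw [← Input.length_toList (y k), E.run_simulator₂, E.view₂_eq_hybrid]
    exact hadv k
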